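/- Let $\Phi$ be a reduced irreducible (crystallographic) root system of rank $\geq 2$ whose Dynkin diagram is simply laced, and let $N_{\alpha,\beta}\in\{\pm1\}$ ($\alpha,\beta,\alpha+\beta\in\Phi$) be the structure constants of the Lie algebra of type $\Phi$ with respect to a Chevalley basis $(e_\alpha)$, i.e. $[e_\alpha,e_\beta]=N_{\alpha,\beta}\,e_{\alpha+\beta}$. For a commutative ring $R$ the Steinberg group $\mathrm{St}(\Phi,R)$ is the group with generators $x_\alpha(a)$, $\alpha\in\Phi$, $a\in R$, and relations $x_\alpha(a)x_\alpha(b)=x_\alpha(a+b)$; $[x_\alpha(a),x_\beta(b)]=x_{\alpha+\beta}(N_{\alpha,\beta}\,ab)$ if $\alpha+\beta\in\Phi$; $[x_\alpha(a),x_\beta(b)]=1$ if $\alpha+\beta\notin\Phi\cup\{0\}$, where $[x,y]=xyx^{-1}y^{-1}$. For an ideal $I$ of $R$ let $\overline{\mathrm{St}}(\Phi,R,I)$ be the kernel of $\mathrm{St}(\Phi,R)\to\mathrm{St}(\Phi,R/I)$. Let $A$ be a (commutative) local ring with maximal ideal $M$, and let $K(A[X],M[X])$ be the kernel of the homomorphism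 $\overline{\mathrm{St}}(\Phi,A[X],M[X])\to\overline{\mathrm{St}}(\Phi,A,M)$ induced by the evaluation $X\mapsto 0$. Then: 1. $K(A[X],M[X])$ is generated as a group by the subgroup $\overline{\mathrm{St}}(\Phi,A[X],XM[X])$ and the elements $[x_\alpha(m),x_{-\alpha}(X\xi)]$, where $m\in M$, $\xi\in A[X]$, $\alpha\in\Phi$. 2. For any fixed root $\gamma\in\Phi$, $K(A[X],M[X])$ is generated as a group by the subgroup $\overline{\mathrm{St}}(\Phi,A[X],XM[X])$ and the elements $[x_\gamma(m),x_{-\gamma}(X\eta)]$, where $m\in M$, $\eta\in A[X]$. -/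

import Mathlib

open Polynomial IsLocalRing
open scoped commutatorElement

noncomputable section

section ChevalleyBasis

variable {ι K V W : Type*} [Field K] [AddCommGroup V] [Module K V] [AddCommGroup W] [Module K W]

/-- A Chevalley basis of a Lie algebra `L` of type `P`: the split Cartan subalgebra is the
coroot space `W` (embedded by `h`), each root space is spanned by one vector `e i`,
`[e_α, e_{-α}]` is the coroot of `α`, and `[e_α, e_β] = N_{α,β} e_{α+β}` for integers `N_{α,β}`
with `N_{-α,-β} = -N_{α,β}` whenever `α + β` is a root.
Values `N i j` for which the sum of the two roots is not a root are irrelevant. -/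
structure ChevalleyBasis (P : RootPairing ι K V W) (L : Type*) [LieRing L] [LieAlgebra K L] where
  /-- the embedding of the Cartan subalgebra -/
  h : W →ₗ[K] L
  /-- the root vectors -/
  e : ι → L
  /-- the structure constants -/
  N : ι → ι → ℤ
  /-- `L` is the direct sum of the Cartan subalgebra and the lines spanned by the root vectors -/
  bijective : Function.Bijective
    fun p : W × (ι →₀ K) => h p.1 + Finsupp.linearCombination K e p.2
  lie_h_h : ∀ w w' : W, ⁅h w, h w'⁆ = 0
  lie_h_e : ∀ (w : W) (i : ι), ⁅h w, e i⁆ = P.root' i w • e i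
  lie_e_neg : ∀ i j : ι, P.root j = -P.root i → ⁅e i, e j⁆ = h (P.coroot i)
  lie_e_e : ∀ i j k : ι, P.root i + P.root j = P.root k → ⁅e i, e j⁆ = N i j • e k
  lie_e_e_eq_zero : ∀ i j : ι, P.root i + P.root j ≠ 0 →
    P.root i + P.root j ∉ Set.range P.root → ⁅e i, e j⁆ = 0
  N_neg : ∀ i j i' j' : ι, P.root i + P.root j ∈ Set.range P.root →
    P.root i' = -P.root i → P.root j' = -P.root j → N i' j' = -N i j

end ChevalleyBasis

section Steinberg

variable {ι K V W : Type*} [Field K] [AddCommGroup V] [Module K V] [AddCommGroup W] [Module K W]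

/-- The Steinberg relators for a simply laced root system with structure constants `N`,
over a commutative ring `R`; the letter `(i, a)` stands for `x_i(a)`. -/
inductive SteinbergRel (P : RootPairing ι K V W) (N : ι → ι → ℤ) (R : Type*) [CommRing R] :
    FreeGroup (ι × R) → Prop
  | add (i : ι) (a b : R) : SteinbergRel P N R
      (FreeGroup.of (i, a) * FreeGroup.of (i, b) * (FreeGroup.of (i, a + b))⁻¹)
  | comm (i j k : ι) (a b : R) (hk : P.root i + P.root j = P.root k) : SteinbergRel P N R
      (⁅FreeGroup.of (i, a), FreeGroup.of (j, b)⁆ * (FreeGroup.of (k, (N i j : R) * (a * b)))⁻¹)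
  | comm_one (i j : ι) (a b : R) (h0 : P.root i + P.root j ≠ 0)
      (hij : P.root i + P.root j ∉ Set.range P.root) : SteinbergRel P N R
      ⁅FreeGroup.of (i, a), FreeGroup.of (j, b)⁆

/-- The Steinberg group `St(Φ, R)` of a simply laced root system `Φ`. -/
abbrev SteinbergGroup (P : RootPairing ι K V W) (N : ι → ι → ℤ) (R : Type*) [CommRing R] : Type _ :=
  PresentedGroup {w | SteinbergRel P N R w}

namespace SteinbergGroup

variable (P : RootPairing ι K V W) (N : ι → ι → ℤ) {R S : Type*} [CommRing R] [CommRing S]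

/-- The generator `x_i(a)`. -/
def x (i : ι) (a : R) : SteinbergGroup P N R := PresentedGroup.of (i, a)

/-- The homomorphism `St(Φ, R) → St(Φ, S)` induced by a ring homomorphism,
`x_i(a) ↦ x_i(f a)`. -/
def map (f : R →+* S) : SteinbergGroup P N R →* SteinbergGroup P N S :=
  PresentedGroup.map (FreeGroup.map fun p : ι × R => (p.1, f p.2)) <| by
    rintro _ (⟨i, a, b⟩ | ⟨i, j, k, a, b, hk⟩ | ⟨i, j, a, b, h0, hij⟩)
    · simpa using SteinbergRel.add (P := P) (N := N) i (f a) (f b)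
    · simpa [map_commutatorElement] using
        SteinbergRel.comm (P := P) (N := N) i j k (f a) (f b) hk
    · simpa [map_commutatorElement] using
        SteinbergRel.comm_one (P := P) (N := N) i j (f a) (f b) h0 hij

theorem map_x (f : R →+* S) (i : ι) (a : R) : map P N f (x P N i a) = x P N i (f a) := rfl

theorem map_map {T : Type*} [CommRing T] (g : S →+* T) (f : R →+* S) (w : SteinbergGroup P N R) :
    map P N g (map P N f w) = map P N (g.comp f) w := by
  have : (map P N g).comp (map P N f) = map P N (g.comp f) :=
    PresentedGroup.ext fun _ => rfl
  exact DFunLike.congr_fun this w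

/-- The relative group `St̄(Φ, R, I)`, the kernel of `St(Φ, R) → St(Φ, R/I)`. -/
def rel (I : Ideal R) : Subgroup (SteinbergGroup P N R) :=
  (map P N (Ideal.Quotient.mk I)).ker

theorem map_mem_rel {I : Ideal R} {J : Ideal S} (f : R →+* S) (hf : I ≤ J.comap f)
    {w : SteinbergGroup P N R} (hw : w ∈ rel P N I) : map P N f w ∈ rel P N J := by
  rw [rel, MonoidHom.mem_ker] at hw ⊢
  rw [map_map, ← Ideal.quotientMap_comp_mk hf, ← map_map, hw, map_one]

/-- The homomorphism `St̄(Φ, R, I) → St̄(Φ, S, J)` induced by a morphism of pairs. -/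
def relMap {I : Ideal R} {J : Ideal S} (f : R →+* S) (hf : I ≤ J.comap f) :
    rel P N I →* rel P N J :=
  ((map P N f).comp (rel P N I).subtype).codRestrict (rel P N J)
    fun w => map_mem_rel P N f hf w.2

/-- `c_i(s, t) = [x_i(s), x_{-i}(t)]`; the index of the root opposite to the `i`-th one is
`P.reflectionPerm i i`. -/
def c (i : ι) (s t : R) : SteinbergGroup P N R :=
  ⁅x P N i s, x P N (P.reflectionPerm i i) t⁆

theorem map_C_le_comap_eval (A : Type*) [CommRing A] (M : Ideal A) :
    M.map (C : A →+* A[X]) ≤ M.comap (evalRingHom (0 : A)) := by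
  rw [Ideal.map_le_iff_le_comap]
  intro m hm
  simpa using hm

/-- `K(A[X], M[X])`: the kernel of `St̄(Φ, A[X], M[X]) → St̄(Φ, A, M)` induced by evaluation
at `0`, regarded as a subgroup of `St(Φ, A[X])`. Here `M[X] = M.map C`. -/
def evalKer (A : Type*) [CommRing A] (M : Ideal A) : Subgroup (SteinbergGroup P N A[X]) :=
  (relMap P N (evalRingHom (0 : A)) (map_C_le_comap_eval A M)).ker.map
    (rel P N (M.map (C : A →+* A[X]))).subtype

end SteinbergGroup

end Steinberg

end

/-!
Let `s ∈ M[X]` and `t ∈ (X)`, so that `s * t ∈ X M[X]`. Modulo the relative group of `X M[X]`,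
i.e. over the quotient ring, where `s * t = 0`, the element `c i s t` is central: conjugation by a
root element multiplies one of its two factors by a root element that commutes with the other one.
Moreover `c (i + j)` is there the inverse of a `c i` whose second argument is rescaled by a unit, so
by irreducibility the elements `c γ` of a single root produce all the others. Let `E` be the
subgroup generated by them and by the relative group of `X M[X]`.

The relative group of an ideal `I` is generated by the conjugates `z i s a` of `x i s` by
`x (-i) a`, `s ∈ I`. Hence, once `E` is killed, the relative groups of `M[X]` and of `(X)` commute.
It follows that the image of the relative group of `M` under `A → A[X]`, multiplied by `E`, is a
normal subgroup. It therefore contains the relative group of `M[X]`, and since evaluation at `0` is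
injective on the first factor, its kernel is exactly `E`.
-/

section RootPairing

variable {ι R M N : Type*} [CommRing R] [AddCommGroup M] [Module R M] [AddCommGroup N] [Module R N]
  {P : RootPairing ι R M N}

variable (P) in
/-- A root pairing is simply laced if its Cartan integers are symmetric. For a reduced irreducible
root system this says that its Dynkin diagram is simply laced, but no base is involved. -/
class IsSimplyLaced [P.IsCrystallographic] : Prop where
  pairingIn_comm : ∀ i j, P.pairingIn ℤ i j = P.pairingIn ℤ j i

variable (P) in
/-- Every root is a sum of two roots: the root pairing has no irreducible component of
type `A₁`. -/
class HasRootSums : Prop where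
  exists_root_add_root_eq : ∀ k, ∃ i j, P.root i + P.root j = P.root k

variable (P) in
/-- The structure constant `N i j` is a unit whenever the sum of the `i`-th and the `j`-th root is a
root. This is what a Chevalley basis contributes to the relations of the Steinberg group. -/
class HasUnitConstants (N : ι → ι → ℤ) : Prop where
  isUnit : ∀ ⦃i j k⦄, P.root i + P.root j = P.root k → IsUnit (N i j)

variable (P) in
theorem nonempty_of_isIrreducible [P.IsRootSystem] [P.IsIrreducible] : Nonempty ι := by
  have := RootPairing.IsIrreducible.nontrivial P
  by_contra! hι
  have := RootPairing.IsRootSystem.span_root_eq_top (P := P)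
  rw [Set.range_eq_empty, Submodule.span_empty] at this
  exact bot_ne_top this

theorem root_reflectionPerm_self (i : ι) : P.root (P.reflectionPerm i i) = -P.root i := by
  rw [P.root_reflectionPerm, P.reflection_apply_self]

theorem reflectionPerm_reflectionPerm_self (i : ι) :
    P.reflectionPerm (P.reflectionPerm i i) (P.reflectionPerm i i) = i :=
  P.root.injective <| by rw [root_reflectionPerm_self, root_reflectionPerm_self, neg_neg]

theorem root_reflectionPerm_add_of_add {i j k : ι} (h : P.root i + P.root j = P.root k) :
    P.root (P.reflectionPerm k k) + P.root i = P.root (P.reflectionPerm j j) := by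
  rw [root_reflectionPerm_self, root_reflectionPerm_self, ← h]
  abel

theorem induction_on_pairing_ne_zero [NeZero (2 : R)] [IsDomain R] [P.IsIrreducible]
    {p : ι → Prop} {i : ι} (hi : p i)
    (hp : ∀ i j, p i → P.pairing i j ≠ 0 → p j) (j : ι) : p j := by
  have : Module.IsReflexive R M := .of_isPerfPair P.toLinearMap
  by_contra hj
  have pairing_eq_zero {k l : ι} (hk : p k) (hl : ¬ p l) : P.pairing k l = 0 :=
    not_not.mp fun h => hl (hp k l hk h)
  have span_eq_top : Submodule.span R (P.root '' {k | p k}) = ⊤ := by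
    refine P.span_root_image_eq_top_of_forall_orthogonal _ ⟨i, hi⟩ fun l hl k hk => ?_
    have := pairing_eq_zero hk fun h => hl (Submodule.subset_span ⟨l, h, rfl⟩)
    exact ⟨P.pairing_eq_zero_iff.mp this, this⟩
  have span_le_ker : Submodule.span R (P.root '' {k | p k}) ≤ LinearMap.ker (P.coroot' j) := by
    rw [Submodule.span_le]
    rintro _ ⟨k, hk, rfl⟩
    exact pairing_eq_zero hk hj
  have : P.coroot' j (P.root j) = 0 := span_le_ker (span_eq_top ▸ Submodule.mem_top)
  exact two_ne_zero ((P.root_coroot'_eq_pairing j j ▸ P.pairing_same j).symm.trans this)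

variable [P.IsCrystallographic]

theorem exists_root_add_of_pairingIn_eq_neg_one {i j : ι} (h : P.pairingIn ℤ i j = -1) :
    ∃ k, P.root i + P.root j = P.root k :=
  ⟨P.reflectionPerm j i, by simp [P.root_reflectionPerm, P.reflection_apply_root' ℤ, h]⟩

namespace IsSimplyLaced

variable [CharZero R]

section Add

variable [IsSimplyLaced P]

theorem pairingIn_add_right {i j k : ι} (h : P.root i + P.root j = P.root k) (l : ι) :
    P.pairingIn ℤ l k = P.pairingIn ℤ l i + P.pairingIn ℤ l j := by
  simp only [pairingIn_comm l, RootPairing.pairingIn_eq_add_of_root_eq_add h.symm]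

theorem pairingIn_eq_neg_one_of_add {i j k : ι} (h : P.root i + P.root j = P.root k) :
    P.pairingIn ℤ i j = -1 := by
  have h₁ := RootPairing.pairingIn_eq_add_of_root_eq_add (S := ℤ) (j := k) h.symm
  have h₂ := pairingIn_add_right h i
  have h₃ := pairingIn_add_right h j
  have h₄ := pairingIn_comm (P := P) i j
  simp only [P.pairingIn_same] at *
  omega

theorem pairingIn_left_eq_one_of_add {i j k : ι} (h : P.root i + P.root j = P.root k) :
    P.pairingIn ℤ i k = 1 := by
  rw [pairingIn_add_right h, P.pairingIn_same, pairingIn_eq_neg_one_of_add h]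
  norm_num

theorem pairingIn_right_eq_one_of_add {i j k : ι} (h : P.root i + P.root j = P.root k) :
    P.pairingIn ℤ j k = 1 :=
  pairingIn_left_eq_one_of_add ((add_comm _ _).trans h)

theorem exists_root_add_root_eq_of_pairingIn_eq_one {i j : ι} (h : P.pairingIn ℤ i j = 1) :
    ∃ k, P.root i + P.root k = P.root j := by
  obtain ⟨k, hk⟩ := exists_root_add_of_pairingIn_eq_neg_one (P := P) (i := j)
    (j := P.reflectionPerm i i) (by rw [P.pairingIn_reflectionPerm_self_right, pairingIn_comm, h])
  exact ⟨k, by rw [← hk, root_reflectionPerm_self]; abel⟩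

theorem pairingIn_eq_one_closed_neg [HasRootSums P] {p : ι → Prop}
    (hp : ∀ i j, p i → P.pairingIn ℤ i j = 1 → p j) {k : ι} (hk : p k) :
    p (P.reflectionPerm k k) := by
  obtain ⟨a, b, hab⟩ := HasRootSums.exists_root_add_root_eq (P := P) k
  have pairing_ab := pairingIn_eq_neg_one_of_add hab
  have pairing_kb := pairingIn_right_eq_one_of_add hab
  have ha : p a := hp k a hk (by rw [pairingIn_comm, pairingIn_left_eq_one_of_add hab])
  have hb : p (P.reflectionPerm b b) :=
    hp a _ ha (by rw [P.pairingIn_reflectionPerm_self_right, pairing_ab, neg_neg])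
  exact hp _ _ hb (by simpa using pairing_kb)

end Add

variable [Finite ι] [IsDomain R]

section Base

variable [P.IsReduced] [P.IsIrreducible] (b : P.Base) (hb : b.cartanMatrix.IsSimplyLaced)

include hb in
theorem form_root_self_eq_of_base (F : P.InvariantForm) (i j : b.support) :
    F.form (P.root i) (P.root i) = F.form (P.root j) (P.root j) := by
  refine b.induction_on_cartanMatrix
    (p := fun k => F.form (P.root k) (P.root k) = F.form (P.root j) (P.root j))
    rfl fun k l hk hlk => ?_
  rcases eq_or_ne l k with rfl | hne
  · exact hk
  have pairing_lk : P.pairingIn ℤ l k = -1 := (hb hne).resolve_left hlk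
  have pairing_kl : P.pairingIn ℤ k l = -1 :=
    (hb hne.symm).resolve_left fun h => hlk (b.cartanMatrix_apply_eq_zero_iff_symm.mp h)
  have := F.pairing_mul_eq_pairing_mul_swap k l
  rw [← P.algebraMap_pairingIn ℤ, ← P.algebraMap_pairingIn ℤ, pairing_kl, pairing_lk] at this
  rw [← hk]
  simpa using this.symm

include hb in
theorem form_root_self_eq (F : P.InvariantForm) (i j : ι) :
    F.form (P.root i) (P.root i) = F.form (P.root j) (P.root j) := by
  have : Nonempty ι := ⟨i⟩
  obtain ⟨i₀, hi₀⟩ : b.support.Nonempty := b.support_nonempty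
  have form_reflection (k l : ι) :
      F.form (P.root (P.reflectionPerm l k)) (P.root (P.reflectionPerm l k)) =
        F.form (P.root k) (P.root k) := by
    simp only [P.root_reflectionPerm, F.apply_reflection_reflection]
  have form_eq (k : ι) : F.form (P.root k) (P.root k) = F.form (P.root i₀) (P.root i₀) :=
    b.induction_reflect k
      (p := fun k => F.form (P.root k) (P.root k) = F.form (P.root i₀) (P.root i₀))
      (fun k hk => (form_reflection k k).trans hk)
      (fun k hk => form_root_self_eq_of_base b hb F ⟨k, hk⟩ ⟨i₀, hi₀⟩)
      fun k l hk _ => (form_reflection k l).trans hk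
  rw [form_eq i, form_eq j]

include hb in
theorem of_base [P.IsRootSystem] : IsSimplyLaced P where
  pairingIn_comm i j := by
    have := Fintype.ofFinite ι
    have := P.pairingIn_pairingIn_mem_set_of_length_eq
      (form_root_self_eq b hb (P.posRootForm ℤ).toInvariantForm i j)
    simp only [Set.mem_insert_iff, Set.mem_singleton_iff, Prod.mk.injEq] at this
    omega

end Base

variable [IsSimplyLaced P]

theorem pairingIn_mem_Icc (i j : ι) : P.pairingIn ℤ i j ∈ Set.Icc (-2) 2 := by
  have := P.pairingIn_pairingIn_mem_set_of_isCrystallographic i j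
  have := pairingIn_comm (P := P) i j
  simp only [Set.mem_insert_iff, Set.mem_singleton_iff, Prod.mk.injEq, Set.mem_Icc] at *
  omega

theorem pairingIn_eq_two_iff {i j : ι} : P.pairingIn ℤ i j = 2 ↔ i = j := by
  have : Module.IsReflexive R M := .of_isPerfPair P.toLinearMap
  rw [← P.pairingIn_two_two_iff ℤ i j, pairingIn_comm j i, and_self]

theorem pairingIn_eq_neg_two_iff {i j : ι} :
    P.pairingIn ℤ i j = -2 ↔ j = P.reflectionPerm i i := by
  rw [eq_comm (a := j), ← pairingIn_eq_two_iff (P := P), P.pairingIn_reflectionPerm_self_left,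
    neg_eq_iff_eq_neg]

theorem pairingIn_eq_neg_one_or_zero_or_one {i j : ι} (h : j ≠ i) (h' : j ≠ P.reflectionPerm i i) :
    P.pairingIn ℤ i j = -1 ∨ P.pairingIn ℤ i j = 0 ∨ P.pairingIn ℤ i j = 1 := by
  have := mt (pairingIn_eq_two_iff (P := P)).mp h.symm
  have := mt (pairingIn_eq_neg_two_iff (P := P)).mp h'
  have := Set.mem_Icc.mp (pairingIn_mem_Icc (P := P) i j)
  omega

variable [P.IsIrreducible]

theorem induction_on_pairingIn_eq_one [HasRootSums P] {p : ι → Prop} {i : ι} (hi : p i)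
    (hp : ∀ i j, p i → P.pairingIn ℤ i j = 1 → p j) (j : ι) : p j := by
  refine induction_on_pairing_ne_zero (P := P) hi (fun k l hk hkl => ?_) j
  rcases eq_or_ne l k with rfl | hne
  · exact hk
  rcases eq_or_ne l (P.reflectionPerm k k) with rfl | hne'
  · exact pairingIn_eq_one_closed_neg hp hk
  rcases pairingIn_eq_neg_one_or_zero_or_one hne hne' with h | h | h
  · exact hp _ _ (pairingIn_eq_one_closed_neg hp hk) (by simp [h])
  · exact absurd (by rw [← P.algebraMap_pairingIn ℤ, h, map_zero]) hkl
  · exact hp _ _ hk h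

theorem hasRootSums (hrank : 2 ≤ Module.finrank R M) : HasRootSums P where
  exists_root_add_root_eq k := by
    have : Module.IsReflexive R M := .of_isPerfPair P.toLinearMap
    by_contra! H
    have pairing_eq_zero {j : ι} (hj : j ≠ k) (hj' : j ≠ P.reflectionPerm k k) :
        P.pairingIn ℤ k j = 0 := by
      rcases pairingIn_eq_neg_one_or_zero_or_one hj hj' with h | h | h
      · obtain ⟨l, hl⟩ := exists_root_add_of_pairingIn_eq_neg_one h
        exact absurd (by rw [← hl, root_reflectionPerm_self, add_neg_cancel_right])
          (H l (P.reflectionPerm j j))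
      · exact h
      · obtain ⟨l, hl⟩ := exists_root_add_root_eq_of_pairingIn_eq_one (P := P) (i := j) (j := k)
          (by rw [pairingIn_comm, h])
        exact absurd hl (H j l)
    have span_eq_top : Submodule.span R (P.root '' {k}) = ⊤ := by
      refine P.span_root_image_eq_top_of_forall_orthogonal _ (Set.singleton_nonempty k)
        fun j hj _ h => ?_
      rw [Set.mem_singleton_iff.mp h, Set.image_singleton] at *
      rw [P.isOrthogonal_iff_pairing_eq_zero, P.pairing_eq_zero_iff, ← P.algebraMap_pairingIn ℤ,
        pairing_eq_zero, map_zero]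
      · rintro rfl
        exact hj (Submodule.mem_span_singleton_self _)
      · rintro rfl
        rw [root_reflectionPerm_self] at hj
        exact hj (neg_mem (Submodule.mem_span_singleton_self _))
    rw [Set.image_singleton] at span_eq_top
    have := finrank_le_one (P.root k) fun v =>
      Submodule.mem_span_singleton.mp (span_eq_top ▸ Submodule.mem_top)
    omega

end IsSimplyLaced

end RootPairing

namespace ChevalleyBasis

variable {ι K V W L : Type*} [Field K] [AddCommGroup V] [Module K V] [AddCommGroup W] [Module K W]
  {P : RootPairing ι K V W} [LieRing L] [LieAlgebra K L] (B : ChevalleyBasis P L)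

theorem e_ne_zero (i : ι) : B.e i ≠ 0 := by
  intro h
  have := B.bijective.1 (a₁ := (0, Finsupp.single i 1)) (a₂ := (0, 0)) (by simp [h])
  simpa using congrArg Prod.snd this

variable [CharZero K] [P.IsCrystallographic] [IsSimplyLaced P]

theorem lie_e_neg_lie_e_e {i j k : ι} (h : P.root i + P.root j = P.root k) :
    ⁅B.e (P.reflectionPerm i i), ⁅B.e i, B.e j⁆⁆ = B.e j := by
  set i' := P.reflectionPerm i i with hi'
  have pairing_ij := IsSimplyLaced.pairingIn_eq_neg_one_of_add h
  have root_i' : P.root i' = -P.root i := root_reflectionPerm_self i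
  have add_ne_zero : P.root i' + P.root j ≠ 0 := by
    intro h₀
    rw [root_i', neg_add_eq_zero] at h₀
    rw [P.root.injective h₀, P.pairingIn_same] at pairing_ij
    omega
  have add_notMem : P.root i' + P.root j ∉ Set.range P.root := by
    rintro ⟨l, hl⟩
    have := IsSimplyLaced.pairingIn_eq_neg_one_of_add hl.symm
    rw [hi', P.pairingIn_reflectionPerm_self_left] at this
    omega
  rw [leibniz_lie, B.lie_e_e_eq_zero i' j add_ne_zero add_notMem, lie_zero, add_zero,
    B.lie_e_neg i' i (by rw [root_i', neg_neg]), B.lie_h_e, P.root'_coroot_eq_pairing,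
    ← P.algebraMap_pairingIn ℤ, hi', P.pairingIn_reflectionPerm_self_right,
    IsSimplyLaced.pairingIn_comm, pairing_ij]
  simp

instance hasUnitConstants : HasUnitConstants P B.N where
  isUnit i j k h := by
    set i' := P.reflectionPerm i i
    have hk : P.root i' + P.root k = P.root j := by
      rw [root_reflectionPerm_self, ← h, neg_add_cancel_left]
    have lie_lie := B.lie_e_neg_lie_e_e h
    rw [B.lie_e_e i j k h, lie_zsmul, B.lie_e_e i' k j hk, smul_smul] at lie_lie
    have mul_smul_e : ((B.N i j * B.N i' k : ℤ) : K) • B.e j = (1 : K) • B.e j := by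
      rw [Int.cast_smul_eq_zsmul, lie_lie, one_smul]
    refine IsUnit.of_mul_eq_one (B.N i' k) ?_
    exact_mod_cast smul_left_injective K (B.e_ne_zero j) mul_smul_e

end ChevalleyBasis

section Commutator

variable {G : Type*} [Group G] {g u v w y : G}

theorem conj_apply_eq_self_iff_commute : MulAut.conj g u = u ↔ Commute g u :=
  mul_inv_eq_iff_eq_mul

theorem commute_commutatorElement (hu : Commute g u) (hv : Commute g v) : Commute g ⁅u, v⁆ := by
  rw [← conj_apply_eq_self_iff_commute] at *
  rw [map_commutatorElement, hu, hv]

theorem commute_commutatorElement_of_conj_left (hgu : MulAut.conj g u = y * u)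
    (hgv : Commute g v) (hyu : Commute y u) (hyv : Commute y v) : Commute g ⁅u, v⁆ := by
  rw [← conj_apply_eq_self_iff_commute, map_commutatorElement, hgu,
    conj_apply_eq_self_iff_commute.mpr hgv, commutatorElement_mul_left_eq_conj_mul,
    hyv.commutator_eq, mul_one]
  exact conj_apply_eq_self_iff_commute.mpr (commute_commutatorElement hyu hyv)

theorem commute_commutatorElement_of_conj_right (hgu : Commute g u)
    (hgv : MulAut.conj g v = y * v) (hyu : Commute y u) (hyv : Commute y v) :
    Commute g ⁅u, v⁆ := by
  rw [← commutatorElement_inv]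
  exact (commute_commutatorElement_of_conj_left hgv hgu hyv hyu).inv_right

theorem commutatorElement_commutatorElement_left (hyu : Commute y u)
    (hyv : MulAut.conj y v = w * v) (hw : Commute w ⁅u, v⁆) : ⁅⁅u, v⁆, y⁆ = ⁅u, w⁆⁻¹ := by
  have conj_y : MulAut.conj y ⁅u, v⁆ = ⁅u, w⁆ * ⁅u, v⁆ := by
    rw [map_commutatorElement, conj_apply_eq_self_iff_commute.mpr hyu, hyv,
      commutatorElement_mul_right_eq_mul_conj, mul_assoc, mul_assoc,
      ← mul_assoc w, ← MulAut.conj_apply, conj_apply_eq_self_iff_commute.mpr hw]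
  rw [conj_eq_commutatorElement_mul, mul_left_inj] at conj_y
  rw [← conj_y, commutatorElement_inv]

theorem commute_map_conj_left {Q : Type*} [Group Q] {φ : G →* Q} :
    Commute (φ (MulAut.conj w u)) (φ v) ↔ Commute (φ u) (φ (MulAut.conj w⁻¹ v)) := by
  rw [← Commute.conj_iff (φ w) (a := φ u), MulAut.conj_apply, MulAut.conj_apply w⁻¹ v]
  simp only [map_mul, map_inv, inv_inv, mul_assoc, mul_inv_cancel_left, mul_inv_cancel, mul_one]

end Commutator

namespace SteinbergGroup

variable {ι K V W : Type*} [Field K] [AddCommGroup V] [Module K V] [AddCommGroup W] [Module K W]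
  (P : RootPairing ι K V W) (N : ι → ι → ℤ) {R : Type*} [CommRing R]

theorem x_mul_x (i : ι) (a b : R) : x P N i a * x P N i b = x P N i (a + b) :=
  mul_inv_eq_one.mp (PresentedGroup.one_of_mem (SteinbergRel.add (P := P) (N := N) i a b))

theorem x_zero (i : ι) : x P N i (0 : R) = 1 := by
  have := x_mul_x P N i (0 : R) 0
  rwa [add_zero, mul_eq_left] at this

theorem x_inv (i : ι) (a : R) : (x P N i a)⁻¹ = x P N i (-a) := by
  rw [inv_eq_iff_mul_eq_one, x_mul_x, add_neg_cancel, x_zero]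

theorem commutator_x {i j k : ι} (h : P.root i + P.root j = P.root k) (a b : R) :
    ⁅x P N i a, x P N j b⁆ = x P N k (N i j * (a * b)) :=
  mul_inv_eq_one.mp (PresentedGroup.one_of_mem (SteinbergRel.comm (P := P) (N := N) i j k a b h))

theorem conj_x {i j k : ι} (h : P.root i + P.root j = P.root k) (a b : R) :
    MulAut.conj (x P N i a) (x P N j b) = x P N k (N i j * (a * b)) * x P N j b := by
  rw [conj_eq_commutatorElement_mul, commutator_x P N h]

theorem map_c {S : Type*} [CommRing S] (f : R →+* S) (i : ι) (s t : R) :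
    map P N f (c P N i s t) = c P N i (f s) (f t) :=
  map_commutatorElement ..

theorem hom_ext {G : Type*} [Group G] {f g : SteinbergGroup P N R →* G}
    (h : ∀ i a, f (x P N i a) = g (x P N i a)) : f = g :=
  PresentedGroup.ext fun p => h p.1 p.2

theorem eq_top_of_x_mem {H : Subgroup (SteinbergGroup P N R)} (h : ∀ i a, x P N i a ∈ H) :
    H = ⊤ := by
  rw [eq_top_iff, ← PresentedGroup.closure_range_of, Subgroup.closure_le]
  rintro _ ⟨⟨i, a⟩, rfl⟩
  exact h i a

theorem normal_of_conj_x_mem {H : Subgroup (SteinbergGroup P N R)}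
    (h : ∀ i a, ∀ g ∈ H, MulAut.conj (x P N i a) g ∈ H) : H.Normal := by
  refine Subgroup.normalizer_eq_top_iff.mp (eq_top_of_x_mem P N fun i a => ?_)
  refine Subgroup.mem_normalizer_iff.mpr fun g => ⟨h i a g, fun hg => ?_⟩
  have := h i (-a) _ hg
  rwa [← x_inv, ← MulAut.conj_apply, ← MulAut.mul_apply, ← map_mul, inv_mul_cancel, map_one] at this

/-- The universal property of the Steinberg group: a family of elements of a group satisfying the
Steinberg relations defines a homomorphism. -/
def lift {G : Type*} [Group G] (f : ι → R → G) (h_add : ∀ i a b, f i a * f i b = f i (a + b))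
    (h_comm : ∀ i j k a b, P.root i + P.root j = P.root k →
      ⁅f i a, f j b⁆ = f k (N i j * (a * b)))
    (h_comm_one : ∀ i j a b, P.root i + P.root j ≠ 0 → P.root i + P.root j ∉ Set.range P.root →
      ⁅f i a, f j b⁆ = 1) : SteinbergGroup P N R →* G :=
  PresentedGroup.toGroup (f := fun p : ι × R => f p.1 p.2) <| by
    rintro _ (⟨i, a, b⟩ | ⟨i, j, k, a, b, hk⟩ | ⟨i, j, a, b, h₀, hij⟩)
    · simp only [map_mul, map_inv, FreeGroup.lift_apply_of, h_add, mul_inv_cancel]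
    · simp only [map_mul, map_inv, map_commutatorElement, FreeGroup.lift_apply_of,
        h_comm i j k a b hk, mul_inv_cancel]
    · simp only [map_commutatorElement, FreeGroup.lift_apply_of, h_comm_one i j a b h₀ hij]

instance rel_normal (I : Ideal R) : (rel P N I).Normal :=
  MonoidHom.normal_ker _

theorem x_mem_rel {I : Ideal R} (i : ι) {a : R} (ha : a ∈ I) : x P N i a ∈ rel P N I := by
  rw [rel, MonoidHom.mem_ker, map_x, Ideal.Quotient.eq_zero_iff_mem.mpr ha, x_zero]

theorem rel_le {I : Ideal R} {H : Subgroup (SteinbergGroup P N R)} [H.Normal]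
    (h : ∀ i, ∀ a ∈ I, x P N i a ∈ H) : rel P N I ≤ H := by
  let mkH := QuotientGroup.mk' H
  obtain ⟨s, mk_s⟩ := (Ideal.Quotient.mk_surjective (I := I)).hasRightInverse
  have mkH_x_congr {i : ι} {a b : R} (hab : Ideal.Quotient.mk I a = Ideal.Quotient.mk I b) :
      mkH (x P N i a) = mkH (x P N i b) := by
    refine QuotientGroup.eq.mpr ?_
    rw [x_inv, x_mul_x, neg_add_eq_sub]
    exact h i _ (Ideal.Quotient.eq.mp hab.symm)
  let f : SteinbergGroup P N (R ⧸ I) →* SteinbergGroup P N R ⧸ H :=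
    lift P N (fun i r => mkH (x P N i (s r)))
      (fun i a b => by
        rw [← map_mul, x_mul_x]
        exact mkH_x_congr (by simp only [map_add, mk_s _]))
      (fun i j k a b hk => by
        rw [← map_commutatorElement, commutator_x P N hk]
        exact mkH_x_congr (by simp only [map_mul, mk_s _, map_intCast]))
      (fun i j a b h₀ hij => by
        rw [← map_commutatorElement]
        exact congrArg mkH (PresentedGroup.one_of_mem (SteinbergRel.comm_one i j _ _ h₀ hij)))
  have f_comp : f.comp (map P N (Ideal.Quotient.mk I)) = mkH :=
    hom_ext P N fun i a => mkH_x_congr (mk_s _)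
  intro g hg
  have : mkH g = 1 := by rw [← f_comp, MonoidHom.comp_apply, MonoidHom.mem_ker.mp hg, map_one]
  exact (QuotientGroup.eq_one_iff g).mp this

theorem rel_mono {I J : Ideal R} (h : I ≤ J) : rel P N I ≤ rel P N J :=
  rel_le P N fun i _ ha => x_mem_rel P N i (h ha)

theorem rel_le_ker_map {S : Type*} [CommRing S] {I : Ideal R} {f : R →+* S}
    (h : I ≤ RingHom.ker f) : rel P N I ≤ (map P N f).ker :=
  rel_le P N fun i a ha => by rw [MonoidHom.mem_ker, map_x, RingHom.mem_ker.mp (h ha), x_zero]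

theorem mul_inv_mem_rel_iff {I : Ideal R} {g h : SteinbergGroup P N R} :
    g * h⁻¹ ∈ rel P N I ↔
      map P N (Ideal.Quotient.mk I) g = map P N (Ideal.Quotient.mk I) h := by
  rw [rel, MonoidHom.mem_ker, map_mul, map_inv, mul_inv_eq_one]

theorem x_eq_commutator [HasUnitConstants P N] {i j k : ι}
    (h : P.root i + P.root j = P.root k) (a : R) :
    x P N k a = ⁅x P N i a, x P N j (N i j : R)⁆ := by
  have N_mul_N : (N i j : R) * N i j = 1 := by
    exact_mod_cast congrArg (Int.cast (R := R))
      (Int.isUnit_mul_self (HasUnitConstants.isUnit (P := P) h))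
  rw [commutator_x P N h, mul_left_comm, N_mul_N, mul_one]

section SimplyLaced

variable [CharZero K] [P.IsCrystallographic] [IsSimplyLaced P]

theorem eq_top_of_x_mem_of_ne [HasRootSums P] [HasUnitConstants P N] {i : ι}
    {H : Subgroup (SteinbergGroup P N R)}
    (h : ∀ l, l ≠ i → l ≠ P.reflectionPerm i i → ∀ a, x P N l a ∈ H) : H = ⊤ := by
  have mem_of_pairing {l : ι} (hl : P.pairingIn ℤ l i = 1 ∨ P.pairingIn ℤ l i = -1) (a : R) :
      x P N l a ∈ H := by
    refine h l ?_ ?_ a <;> rintro rfl <;> simp at hl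
  refine eq_top_of_x_mem P N fun l a => ?_
  by_cases hl : l ≠ i ∧ l ≠ P.reflectionPerm i i
  · exact h l hl.1 hl.2 a
  obtain ⟨d, e, hde⟩ := HasRootSums.exists_root_add_root_eq (P := P) l
  have pairing_dl := IsSimplyLaced.pairingIn_left_eq_one_of_add hde
  have pairing_el := IsSimplyLaced.pairingIn_right_eq_one_of_add hde
  have mem_of_pairing_l {m : ι} (hm : P.pairingIn ℤ m l = 1) (a : R) : x P N m a ∈ H := by
    refine mem_of_pairing ?_ a
    rcases not_and_or.mp hl with hl | hl <;> rw [not_not] at hl <;> subst hl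
    · exact .inl hm
    · exact .inr (by rwa [P.pairingIn_reflectionPerm_self_right, neg_eq_iff_eq_neg] at hm)
  rw [x_eq_commutator P N hde, commutatorElement_def]
  have hd := mem_of_pairing_l pairing_dl a
  have he := mem_of_pairing_l pairing_el (N d e : R)
  exact H.mul_mem (H.mul_mem (H.mul_mem hd he) (H.inv_mem hd)) (H.inv_mem he)

variable [Finite ι]

theorem commute_x_of_nonneg {i j : ι} (h : 0 ≤ P.pairingIn ℤ i j) (a b : R) :
    Commute (x P N i a) (x P N j b) := by
  rw [← commutatorElement_eq_one_iff_commute]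
  refine PresentedGroup.one_of_mem (SteinbergRel.comm_one i j a b (fun h₀ => ?_) ?_)
  · have : Module.IsReflexive K V := .of_isPerfPair P.toLinearMap
    have := (P.pairingIn_neg_two_neg_two_iff ℤ i j).mpr (eq_neg_of_add_eq_zero_left h₀)
    omega
  · rintro ⟨k, hk⟩
    have := IsSimplyLaced.pairingIn_eq_neg_one_of_add hk.symm
    omega

theorem commute_x_of_mul_eq_zero {i j : ι} (h : -1 ≤ P.pairingIn ℤ i j) {a b : R}
    (hab : a * b = 0) : Commute (x P N i a) (x P N j b) := by
  rcases h.eq_or_lt with h | h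
  · obtain ⟨k, hk⟩ := exists_root_add_of_pairingIn_eq_neg_one h.symm
    rw [← commutatorElement_eq_one_iff_commute, commutator_x P N hk, hab, mul_zero, x_zero]
  · exact commute_x_of_nonneg P N (by omega) a b

/- The commutation relations only multiply one of the two factors of `c_i(a, b)` by an `x_k`
whose argument is a multiple of `a` or of `b`, and `a * b = 0` makes this `x_k` commute with both
factors. -/
theorem commute_x_c_of_ne {i l : ι} (hl : l ≠ i) (hl' : l ≠ P.reflectionPerm i i) {a b : R}
    (hab : a * b = 0) (r : R) : Commute (x P N l r) (c P N i a b) := by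
  have pairing_comm := IsSimplyLaced.pairingIn_comm (P := P) i l
  have pairing_ii := P.pairingIn_same (S := ℤ) i
  rcases IsSimplyLaced.pairingIn_eq_neg_one_or_zero_or_one hl hl' with h | h | h
  · obtain ⟨k, hk⟩ := exists_root_add_of_pairingIn_eq_neg_one (pairing_comm.symm.trans h)
    have pairing_ki := RootPairing.pairingIn_eq_add_of_root_eq_add (S := ℤ) (j := i) hk.symm
    refine commute_commutatorElement_of_conj_left (conj_x P N hk r a)
      (commute_x_of_nonneg P N ?_ _ _) (commute_x_of_nonneg P N ?_ _ _)
      (commute_x_of_mul_eq_zero P N ?_ (by linear_combination (N l i * r : R) * hab))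
    all_goals try rw [P.pairingIn_reflectionPerm_self_right]
    all_goals omega
  · refine commute_commutatorElement (commute_x_of_nonneg P N ?_ _ _)
      (commute_x_of_nonneg P N ?_ _ _)
    all_goals try rw [P.pairingIn_reflectionPerm_self_right]
    all_goals omega
  · obtain ⟨k, hk⟩ := exists_root_add_of_pairingIn_eq_neg_one (P := P) (i := l)
      (j := P.reflectionPerm i i)
      (by rw [P.pairingIn_reflectionPerm_self_right, ← pairing_comm, h])
    have pairing_ki := RootPairing.pairingIn_eq_add_of_root_eq_add (S := ℤ) (j := i) hk.symm
    rw [P.pairingIn_reflectionPerm_self_left] at pairing_ki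
    refine commute_commutatorElement_of_conj_right (commute_x_of_nonneg P N ?_ _ _)
      (conj_x P N hk r b)
      (commute_x_of_mul_eq_zero P N ?_ (by
        linear_combination (N l (P.reflectionPerm i i) * r : R) * hab))
      (commute_x_of_nonneg P N ?_ _ _)
    all_goals try rw [P.pairingIn_reflectionPerm_self_right]
    all_goals omega

variable [HasUnitConstants P N]

theorem c_mem_center [HasRootSums P] (i : ι) {a b : R} (hab : a * b = 0) :
    c P N i a b ∈ Subgroup.center (SteinbergGroup P N R) := by
  have centralizer_eq_top : Subgroup.centralizer {c P N i a b} = ⊤ :=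
    eq_top_of_x_mem_of_ne P N fun l hl hl' r =>
      Subgroup.mem_centralizer_singleton_iff.mpr (commute_x_c_of_ne P N hl hl' hab r).eq
  refine Subgroup.mem_center_iff.mpr fun g => Subgroup.mem_centralizer_singleton_iff.mp ?_
  rw [centralizer_eq_top]
  exact Subgroup.mem_top g

theorem c_eq_inv_c {i j k : ι} (h : P.root i + P.root j = P.root k) {a b : R} (hab : a * b = 0) :
    c P N k a b = (c P N i a (N (P.reflectionPerm k k) j * (b * N i j)))⁻¹ := by
  have pairing_ik := IsSimplyLaced.pairingIn_left_eq_one_of_add h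
  have pairing_ki := IsSimplyLaced.pairingIn_comm (P := P) k i
  have hroot : P.root (P.reflectionPerm k k) + P.root j = P.root (P.reflectionPerm i i) :=
    root_reflectionPerm_add_of_add ((add_comm _ _).trans h)
  rw [c, x_eq_commutator P N h]
  refine commutatorElement_commutatorElement_left
    (commute_x_of_mul_eq_zero P N ?_ (by rw [mul_comm, hab])) (conj_x P N hroot _ _) ?_
  · rw [P.pairingIn_reflectionPerm_self_left]
    omega
  · rw [← x_eq_commutator P N h]
    refine commute_x_of_mul_eq_zero P N ?_ ?_
    · rw [P.pairingIn_reflectionPerm_self_left]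
      omega
    · linear_combination (N (P.reflectionPerm k k) j * N i j : R) * hab

theorem commutator_c_mem_rel [HasRootSums P] {I : Ideal R} (i : ι) {a b : R} (hab : a * b ∈ I)
    (g : SteinbergGroup P N R) : ⁅g, c P N i a b⁆ ∈ rel P N I := by
  have mk_mul_mk : Ideal.Quotient.mk I a * Ideal.Quotient.mk I b = 0 := by
    rw [← map_mul, Ideal.Quotient.eq_zero_iff_mem.mpr hab]
  rw [rel, MonoidHom.mem_ker, map_commutatorElement, map_c, commutatorElement_eq_one_iff_mul_comm]
  exact Subgroup.mem_center_iff.mp (c_mem_center P N i mk_mul_mk) _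

theorem c_mul_c_mem_rel {I : Ideal R} {i j k : ι} (h : P.root i + P.root j = P.root k) {a b : R}
    (hab : a * b ∈ I) :
    c P N k a b * c P N i a (N (P.reflectionPerm k k) j * (b * N i j)) ∈ rel P N I := by
  have mk_mul_mk : Ideal.Quotient.mk I a * Ideal.Quotient.mk I b = 0 := by
    rw [← map_mul, Ideal.Quotient.eq_zero_iff_mem.mpr hab]
  rw [rel, MonoidHom.mem_ker, map_mul, map_c, map_c, c_eq_inv_c P N h mk_mul_mk]
  simp only [map_mul, map_intCast, inv_mul_cancel]

end SimplyLaced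

section Elementary

/-- The subgroup generated by the `x_i(s)` with `s ∈ I`. -/
def elem (I : Ideal R) : Subgroup (SteinbergGroup P N R) :=
  Subgroup.closure {g | ∃ i, ∃ s ∈ I, g = x P N i s}

/-- The conjugate of `x_i(s)` by `x_{-i}(a)`. The `z_i(s, a)` with `s` in an ideal `I`
generate `rel I`. -/
def z (i : ι) (s a : R) : SteinbergGroup P N R :=
  MulAut.conj (x P N (P.reflectionPerm i i) a) (x P N i s)

/-- The subgroup generated by the `z_i(s, a)` with `s ∈ I`; it turns out to be `rel I`. -/
def zClosure (I : Ideal R) : Subgroup (SteinbergGroup P N R) :=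
  Subgroup.closure {g | ∃ i, ∃ s ∈ I, ∃ a, g = z P N i s a}

variable {P N} {I : Ideal R}

theorem x_mem_elem (i : ι) {s : R} (hs : s ∈ I) : x P N i s ∈ elem P N I :=
  Subgroup.subset_closure ⟨i, s, hs, rfl⟩

theorem elem_le {H : Subgroup (SteinbergGroup P N R)} (h : ∀ i, ∀ s ∈ I, x P N i s ∈ H) :
    elem P N I ≤ H := by
  rw [elem, Subgroup.closure_le]
  rintro _ ⟨i, s, hs, rfl⟩
  exact h i s hs

theorem conj_mem_of_mem_elem {H : Subgroup (SteinbergGroup P N R)} {w : SteinbergGroup P N R}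
    (h : ∀ i, ∀ s ∈ I, MulAut.conj w (x P N i s) ∈ H) {g : SteinbergGroup P N R}
    (hg : g ∈ elem P N I) : MulAut.conj w g ∈ H :=
  elem_le (H := H.comap (MulAut.conj w).toMonoidHom) h hg

/- Write `x_i(s)` as the commutator of `x_d(s)` with an `x_e`, where `i = d + e`; conjugation by
`x_{-i}(a)` only moves the two factors by `x_{-e}` and `x_{-d}`. -/
theorem z_eq_commutator [HasUnitConstants P N] {d e i : ι}
    (h : P.root d + P.root e = P.root i) (s a : R) :
    z P N i s a =
      ⁅x P N (P.reflectionPerm e e) (N (P.reflectionPerm i i) d * (a * s)) * x P N d s,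
        x P N (P.reflectionPerm d d) (N (P.reflectionPerm i i) e * (a * N d e)) *
          x P N e (N d e : R)⁆ := by
  rw [z, x_eq_commutator P N h s, map_commutatorElement,
    conj_x P N (root_reflectionPerm_add_of_add h),
    conj_x P N (root_reflectionPerm_add_of_add ((add_comm _ _).trans h))]

theorem z_mem_zClosure (i : ι) {s : R} (hs : s ∈ I) (a : R) : z P N i s a ∈ zClosure P N I :=
  Subgroup.subset_closure ⟨i, s, hs, a, rfl⟩

theorem zClosure_le {H : Subgroup (SteinbergGroup P N R)}
    (h : ∀ i, ∀ s ∈ I, ∀ a, z P N i s a ∈ H) : zClosure P N I ≤ H := by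
  rw [zClosure, Subgroup.closure_le]
  rintro _ ⟨i, s, hs, a, rfl⟩
  exact h i s hs a

theorem x_mem_zClosure (i : ι) {s : R} (hs : s ∈ I) : x P N i s ∈ zClosure P N I := by
  simpa only [z, x_zero, map_one, MulAut.one_apply] using
    z_mem_zClosure (P := P) (N := N) i hs 0

theorem elem_le_zClosure : elem P N I ≤ zClosure P N I :=
  elem_le fun i _ hs => x_mem_zClosure i hs

section Commute

variable {Q : Type*} [Group Q] {φ : SteinbergGroup P N R →* Q} {q : Q} {g : SteinbergGroup P N R}

theorem commute_map_of_mem_elem (h : ∀ i, ∀ s ∈ I, Commute (φ (x P N i s)) q)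
    (hg : g ∈ elem P N I) : Commute (φ g) q :=
  Subgroup.mem_centralizer_singleton_iff.mp <|
    elem_le (H := (Subgroup.centralizer {q}).comap φ)
      (fun i s hs => Subgroup.mem_centralizer_singleton_iff.mpr (h i s hs)) hg

theorem commute_map_of_mem_zClosure (h : ∀ i, ∀ s ∈ I, ∀ a, Commute (φ (z P N i s a)) q)
    (hg : g ∈ zClosure P N I) : Commute (φ g) q :=
  Subgroup.mem_centralizer_singleton_iff.mp <|
    zClosure_le (H := (Subgroup.centralizer {q}).comap φ)
      (fun i s hs a => Subgroup.mem_centralizer_singleton_iff.mpr (h i s hs a)) hg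

theorem commute_map_of_mem_elem_of_mem_elem {J : Ideal R}
    (hφ : ∀ i j, ∀ s ∈ I, ∀ t ∈ J, Commute (φ (x P N i s)) (φ (x P N j t)))
    {g h : SteinbergGroup P N R} (hg : g ∈ elem P N I) (hh : h ∈ elem P N J) :
    Commute (φ g) (φ h) :=
  commute_map_of_mem_elem (fun i s hs =>
    (commute_map_of_mem_elem (fun j t ht => (hφ i j s hs t ht).symm) hh).symm) hg

end Commute

variable [Finite ι] [CharZero K] [P.IsCrystallographic] [IsSimplyLaced P]

theorem conj_x_mem_elem {i j : ι} (h : -1 ≤ P.pairingIn ℤ i j) (r : R) {s : R} (hs : s ∈ I) :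
    MulAut.conj (x P N i r) (x P N j s) ∈ elem P N I := by
  rcases h.eq_or_lt with h | h
  · obtain ⟨k, hk⟩ := exists_root_add_of_pairingIn_eq_neg_one h.symm
    rw [conj_x P N hk]
    exact mul_mem (x_mem_elem k (I.mul_mem_left _ (I.mul_mem_left _ hs))) (x_mem_elem j hs)
  · rw [conj_apply_eq_self_iff_commute.mpr (commute_x_of_nonneg P N (by omega) r s)]
    exact x_mem_elem j hs

theorem conj_x_mem_zClosure (l : ι) (r : R) {g : SteinbergGroup P N R} (hg : g ∈ elem P N I) :
    MulAut.conj (x P N l r) g ∈ zClosure P N I := by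
  refine conj_mem_of_mem_elem (fun i s hs => ?_) hg
  by_cases h : P.pairingIn ℤ i l = -2
  · rw [IsSimplyLaced.pairingIn_eq_neg_two_iff.mp h]
    exact z_mem_zClosure i hs r
  · have := (IsSimplyLaced.pairingIn_mem_Icc (P := P) i l).1
    have := IsSimplyLaced.pairingIn_comm (P := P) i l
    exact elem_le_zClosure (conj_x_mem_elem (by omega) r hs)

theorem conj_x_mul_x_mem_zClosure {l m : ι} (h : l ≠ m) (h' : l ≠ P.reflectionPerm m m) (r q : R)
    {g : SteinbergGroup P N R} (hg : g ∈ elem P N I) :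
    MulAut.conj (x P N l r * x P N m q) g ∈ zClosure P N I := by
  refine conj_mem_of_mem_elem (fun j s hs => ?_) hg
  by_cases hj : P.pairingIn ℤ m j = -2
  · rw [IsSimplyLaced.pairingIn_eq_neg_two_iff] at hj
    subst hj
    have swap : x P N l r * x P N m q = x P N m q * MulAut.conj (x P N m (-q)) (x P N l r) := by
      rw [← x_inv, MulAut.conj_apply]
      group
    rw [swap, map_mul, MulAut.mul_apply]
    refine conj_x_mem_zClosure m q ?_
    have := IsSimplyLaced.pairingIn_comm (P := P) m l
    rcases IsSimplyLaced.pairingIn_eq_neg_one_or_zero_or_one h h' with hml | hml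
    · obtain ⟨k, hk⟩ := exists_root_add_of_pairingIn_eq_neg_one hml
      have := IsSimplyLaced.pairingIn_left_eq_one_of_add hk
      have := IsSimplyLaced.pairingIn_comm (P := P) m k
      rw [conj_x P N hk, map_mul, MulAut.mul_apply, conj_apply_eq_self_iff_commute.mpr
        (commute_x_of_nonneg P N (by rw [P.pairingIn_reflectionPerm_self_right]; omega) _ _)]
      exact conj_x_mem_elem (by rw [P.pairingIn_reflectionPerm_self_right]; omega) _ hs
    · rw [conj_apply_eq_self_iff_commute.mpr (commute_x_of_nonneg P N (by omega) _ _)]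
      exact conj_x_mem_elem (by rw [P.pairingIn_reflectionPerm_self_right]; omega) _ hs
  · have := (IsSimplyLaced.pairingIn_mem_Icc (P := P) m j).1
    rw [map_mul, MulAut.mul_apply]
    exact conj_x_mem_zClosure l r (conj_x_mem_elem (by omega) q hs)

theorem conj_z_mem_zClosure_of_ne {l i : ι} (h : l ≠ i) (r : R) {s : R} (hs : s ∈ I) (a : R) :
    MulAut.conj (x P N l r) (z P N i s a) ∈ zClosure P N I := by
  rw [z, ← MulAut.mul_apply, ← map_mul]
  rcases eq_or_ne l (P.reflectionPerm i i) with rfl | h'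
  · rw [x_mul_x]
    exact z_mem_zClosure i hs _
  · exact conj_x_mul_x_mem_zClosure h' (by rwa [reflectionPerm_reflectionPerm_self]) r a
      (x_mem_elem i hs)

variable [HasUnitConstants P N]

theorem conj_z_self_mem_zClosure [HasRootSums P] (i : ι) (r : R) {s : R} (hs : s ∈ I) (a : R) :
    MulAut.conj (x P N i r) (z P N i s a) ∈ zClosure P N I := by
  obtain ⟨d, e, h⟩ := HasRootSums.exists_root_add_root_eq (P := P) i
  have pairing_de := IsSimplyLaced.pairingIn_eq_neg_one_of_add h
  have pairing_ed := IsSimplyLaced.pairingIn_comm (P := P) d e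
  have pairing_di := IsSimplyLaced.pairingIn_left_eq_one_of_add h
  have pairing_ei := IsSimplyLaced.pairingIn_right_eq_one_of_add h
  rw [z_eq_commutator h]
  set t : R := N (P.reflectionPerm i i) d * (a * s)
  set p : R := N (P.reflectionPerm i i) e * (a * N d e)
  set n : R := (N d e : R)
  have ht : t ∈ I := I.mul_mem_left _ (I.mul_mem_left _ hs)
  have commute_v : Commute (x P N (P.reflectionPerm d d) p) (x P N e n) :=
    commute_x_of_nonneg P N (by rw [P.pairingIn_reflectionPerm_self_left]; omega) _ _
  have conj_x_d : MulAut.conj (x P N i r)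
      (MulAut.conj (x P N (P.reflectionPerm d d) p * x P N e n) (x P N d s)) ∈
        zClosure P N I := by
    rw [map_mul, MulAut.mul_apply, ← MulAut.mul_apply, ← map_mul]
    refine conj_x_mul_x_mem_zClosure ?_ ?_ r p (conj_x_mem_elem (by omega) n hs)
    all_goals rintro rfl; simp at pairing_di
  have conj_x_e : MulAut.conj (x P N i r)
      (MulAut.conj (x P N (P.reflectionPerm d d) p * x P N e n)
        (x P N (P.reflectionPerm e e) t)) ∈ zClosure P N I := by
    rw [commute_v.eq, map_mul, MulAut.mul_apply, ← MulAut.mul_apply, ← map_mul]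
    refine conj_x_mul_x_mem_zClosure ?_ ?_ r n (conj_x_mem_elem ?_ p ht)
    · rintro rfl; simp at pairing_ei
    · rintro rfl; simp at pairing_ei
    · simpa using pairing_de.ge
  rw [commutatorElement_def, mul_assoc, mul_assoc, ← mul_assoc (_ * _) (_⁻¹), ← MulAut.conj_apply,
    map_mul, map_inv, map_inv, map_mul (MulAut.conj (_ * _)), map_mul _ (MulAut.conj _ _)]
  exact mul_mem (conj_x_mem_zClosure _ _ (mul_mem (x_mem_elem _ ht) (x_mem_elem _ hs)))
    (inv_mem (mul_mem conj_x_e conj_x_d))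

instance zClosure_normal [HasRootSums P] : (zClosure P N I).Normal := by
  refine normal_of_conj_x_mem P N fun l r g hg => ?_
  refine zClosure_le (H := (zClosure P N I).comap (MulAut.conj (x P N l r)).toMonoidHom)
    (fun i s hs a => ?_) hg
  rcases eq_or_ne l i with rfl | h
  · exact conj_z_self_mem_zClosure l r hs a
  · exact conj_z_mem_zClosure_of_ne h r hs a

theorem rel_le_zClosure [HasRootSums P] : rel P N I ≤ zClosure P N I :=
  rel_le P N fun i _ ha => x_mem_zClosure i ha

section CommutingImages

variable {J : Ideal R} {Q : Type*} [Group Q] {φ : SteinbergGroup P N R →* Q}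

variable [HasRootSums P]
  (hφ : ∀ i j, ∀ s ∈ I, ∀ t ∈ J, Commute (φ (x P N i s)) (φ (x P N j t)))

include hφ

theorem commute_map_z_x_self (i : ι) {s t : R} (hs : s ∈ I) (ht : t ∈ J) (a : R) :
    Commute (φ (z P N i s a)) (φ (x P N i t)) := by
  obtain ⟨d, e, h⟩ := HasRootSums.exists_root_add_root_eq (P := P) i
  have pairing_de := IsSimplyLaced.pairingIn_eq_neg_one_of_add h
  have pairing_di := IsSimplyLaced.pairingIn_left_eq_one_of_add h
  have pairing_ei := IsSimplyLaced.pairingIn_right_eq_one_of_add h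
  rw [z_eq_commutator h, commutatorElement_def]
  set r : R := N (P.reflectionPerm i i) d * (a * s)
  set p : R := N (P.reflectionPerm i i) e * (a * N d e)
  set n : R := (N d e : R)
  set u := x P N (P.reflectionPerm e e) r * x P N d s
  have hu : u ∈ elem P N I :=
    mul_mem (x_mem_elem _ (I.mul_mem_left _ (I.mul_mem_left _ hs))) (x_mem_elem _ hs)
  rw [mul_assoc, mul_assoc, ← mul_assoc _ u⁻¹, ← MulAut.conj_apply, map_mul]
  refine (commute_map_of_mem_elem_of_mem_elem hφ hu (x_mem_elem i ht)).mul_left ?_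
  rw [commute_map_conj_left]
  refine commute_map_of_mem_elem_of_mem_elem hφ (inv_mem hu) ?_
  have commute_v : Commute (x P N (P.reflectionPerm d d) p) (x P N e n) :=
    commute_x_of_nonneg P N (by rw [P.pairingIn_reflectionPerm_self_left]; omega) _ _
  have commute_e : Commute (x P N e (-n)) (x P N i t) :=
    commute_x_of_nonneg P N (by omega) _ _
  rw [commute_v.eq, mul_inv_rev, x_inv, x_inv, map_mul, MulAut.mul_apply,
    conj_apply_eq_self_iff_commute.mpr commute_e]
  exact conj_x_mem_elem (by rw [P.pairingIn_reflectionPerm_self_left]; omega) _ ht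

theorem commute_map_z_x (i j : ι) {s t : R} (hs : s ∈ I) (ht : t ∈ J) (a : R) :
    Commute (φ (z P N i s a)) (φ (x P N j t)) := by
  rcases eq_or_ne i j with rfl | hij
  · exact commute_map_z_x_self hφ i hs ht a
  have := mt (IsSimplyLaced.pairingIn_eq_two_iff (P := P)).mp hij
  have := (IsSimplyLaced.pairingIn_mem_Icc (P := P) i j).2
  rw [z, commute_map_conj_left, x_inv]
  refine commute_map_of_mem_elem_of_mem_elem hφ (x_mem_elem i hs) (conj_x_mem_elem ?_ _ ht)
  rw [P.pairingIn_reflectionPerm_self_left]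
  omega

theorem commute_map_of_mem_rel {g h : SteinbergGroup P N R} (hg : g ∈ rel P N I)
    (hh : h ∈ rel P N J) : Commute (φ g) (φ h) := by
  refine (commute_map_of_mem_zClosure (fun j t ht b => ?_) (rel_le_zClosure hh)).symm
  rw [z, commute_map_conj_left, Commute.symm_iff]
  exact commute_map_of_mem_zClosure (fun i s hs a => commute_map_z_x hφ i j hs ht a)
    (rel_le_zClosure ((rel_normal P N I).conj_mem g hg _))

end CommutingImages

end Elementary

variable {P N}

section Crossed

variable (P N) in
/-- The subgroup generated by `rel (I * J)` and the elements `c_i(s, t)` with `i ∈ Γ`, `s ∈ I` and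
`t ∈ J`. For `Γ` nonempty it contains the commutator `⁅rel I, rel J⁆`. -/
def crossed (Γ : Set ι) (I J : Ideal R) : Subgroup (SteinbergGroup P N R) :=
  Subgroup.closure ((rel P N (I * J) : Set _) ∪ {g | ∃ i ∈ Γ, ∃ s ∈ I, ∃ t ∈ J, g = c P N i s t})

variable {Γ : Set ι} {I J : Ideal R}

theorem rel_mul_le_crossed : rel P N (I * J) ≤ crossed P N Γ I J :=
  fun _ hg => Subgroup.subset_closure (.inl hg)

theorem c_mem_crossed {i : ι} (hi : i ∈ Γ) {s t : R} (hs : s ∈ I) (ht : t ∈ J) :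
    c P N i s t ∈ crossed P N Γ I J :=
  Subgroup.subset_closure (.inr ⟨i, hi, s, hs, t, ht, rfl⟩)

theorem crossed_le {H : Subgroup (SteinbergGroup P N R)} (h_rel : rel P N (I * J) ≤ H)
    (h_c : ∀ i ∈ Γ, ∀ s ∈ I, ∀ t ∈ J, c P N i s t ∈ H) : crossed P N Γ I J ≤ H := by
  rw [crossed, Subgroup.closure_le]
  rintro _ (hg | ⟨i, hi, s, hs, t, ht, rfl⟩)
  · exact h_rel hg
  · exact h_c i hi s hs t ht

variable [Finite ι] [CharZero K] [P.IsCrystallographic] [IsSimplyLaced P] [HasRootSums P]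
  [HasUnitConstants P N]

instance crossed_normal : (crossed P N Γ I J).Normal where
  conj_mem g hg w := by
    refine crossed_le (H := (crossed P N Γ I J).comap (MulAut.conj w).toMonoidHom)
      (fun g hg => rel_mul_le_crossed ((rel_normal P N _).conj_mem g hg w))
      (fun i hi s hs t ht => ?_) hg
    change MulAut.conj w _ ∈ crossed P N Γ I J
    rw [conj_eq_commutatorElement_mul]
    exact mul_mem (rel_mul_le_crossed (commutator_c_mem_rel P N i (Ideal.mul_mem_mul hs ht) w))
      (c_mem_crossed hi hs ht)

variable [P.IsIrreducible]

theorem c_mem_crossed_of_nonempty (hΓ : Γ.Nonempty) (i : ι) {s t : R} (hs : s ∈ I) (ht : t ∈ J) :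
    c P N i s t ∈ crossed P N Γ I J := by
  obtain ⟨γ, hγ⟩ := hΓ
  suffices ∀ t ∈ J, c P N i s t ∈ crossed P N Γ I J from this t ht
  refine IsSimplyLaced.induction_on_pairingIn_eq_one (P := P) (i := γ)
    (p := fun i => ∀ t ∈ J, c P N i s t ∈ crossed P N Γ I J)
    (fun t ht => c_mem_crossed hγ hs ht) (fun j k hj hjk t ht => ?_) i
  obtain ⟨l, h⟩ := IsSimplyLaced.exists_root_add_root_eq_of_pairingIn_eq_one hjk
  refine (Subgroup.mul_mem_cancel_right _ (hj _ ?_)).mp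
    (rel_mul_le_crossed (c_mul_c_mem_rel P N h (Ideal.mul_mem_mul hs ht)))
  exact J.mul_mem_left _ (J.mul_mem_right _ ht)

theorem commutator_x_mem_crossed (hΓ : Γ.Nonempty) (i j : ι) {s t : R} (hs : s ∈ I) (ht : t ∈ J) :
    ⁅x P N i s, x P N j t⁆ ∈ crossed P N Γ I J := by
  have := (IsSimplyLaced.pairingIn_mem_Icc (P := P) i j).1
  by_cases h : P.pairingIn ℤ i j = -2
  · rw [IsSimplyLaced.pairingIn_eq_neg_two_iff.mp h]
    exact c_mem_crossed_of_nonempty hΓ i hs ht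
  by_cases h' : P.pairingIn ℤ i j = -1
  · obtain ⟨k, hk⟩ := exists_root_add_of_pairingIn_eq_neg_one h'
    rw [commutator_x P N hk]
    exact rel_mul_le_crossed
      (x_mem_rel P N k (Ideal.mul_mem_left _ _ (Ideal.mul_mem_mul hs ht)))
  · rw [(commute_x_of_nonneg P N (by omega) s t).commutator_eq]
    exact one_mem _

theorem commutator_rel_le_crossed (hΓ : Γ.Nonempty) :
    ⁅rel P N I, rel P N J⁆ ≤ crossed P N Γ I J := by
  have commute_mk_iff {g h : SteinbergGroup P N R} :
      Commute (QuotientGroup.mk' (crossed P N Γ I J) g) (QuotientGroup.mk' _ h) ↔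
        ⁅g, h⁆ ∈ crossed P N Γ I J := by
    rw [← commutatorElement_eq_one_iff_commute, ← map_commutatorElement]
    exact QuotientGroup.eq_one_iff _
  exact Subgroup.commutator_le.mpr fun g hg h hh => commute_mk_iff.mp <|
    commute_map_of_mem_rel (fun i j s hs t ht =>
      commute_mk_iff.mpr (commutator_x_mem_crossed hΓ i j hs ht)) hg hh

end Crossed

section Split

variable {A : Type*} [CommRing A] {M : Ideal A} {σ : A →+* R} {ε : R →+* A}

theorem map_map_of_comp_eq_id (hσ : ε.comp σ = RingHom.id A) (v : SteinbergGroup P N A) :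
    map P N ε (map P N σ v) = v := by
  have : map P N (RingHom.id A) = MonoidHom.id _ := hom_ext P N fun i a => by simp [map_x]
  rw [map_map, hσ, this, MonoidHom.id_apply]

theorem sub_map_mem_ker (hσ : ε.comp σ = RingHom.id A) (r : R) : r - σ (ε r) ∈ RingHom.ker ε := by
  rw [RingHom.mem_ker, map_sub, ← RingHom.comp_apply ε σ, hσ, RingHom.id_apply, sub_self]

theorem apply_mem_of_mem_map (hσ : ε.comp σ = RingHom.id A) {s : R} (hs : s ∈ M.map σ) :
    ε s ∈ M := by
  have := Ideal.mem_map_of_mem ε hs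
  rwa [Ideal.map_map, hσ, Ideal.map_id] at this

theorem sub_map_mem_map_mul_ker (hσ : ε.comp σ = RingHom.id A) {s : R} (hs : s ∈ M.map σ) :
    s - σ (ε s) ∈ M.map σ * RingHom.ker ε := by
  induction hs using Submodule.span_induction with
  | mem s hs =>
    obtain ⟨m, -, rfl⟩ := hs
    rw [← RingHom.comp_apply ε σ, hσ, RingHom.id_apply, sub_self]
    exact zero_mem _
  | zero => simp
  | add s s' _ _ hs hs' =>
    rw [map_add, map_add, add_sub_add_comm]
    exact add_mem hs hs'
  | smul r s hs_mem hs =>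
    have expand : r * s - σ (ε r) * σ (ε s) = σ (ε r) * (s - σ (ε s)) + s * (r - σ (ε r)) := by
      ring
    rw [smul_eq_mul, map_mul, map_mul, expand]
    exact add_mem (Ideal.mul_mem_left _ _ hs) (Ideal.mul_mem_mul hs_mem (sub_map_mem_ker hσ r))

variable (σ ε) in
theorem x_eq_x_mul_map_x (i : ι) (r : R) :
    x P N i r = x P N i (r - σ (ε r)) * map P N σ (x P N i (ε r)) := by
  rw [map_x, x_mul_x, sub_add_cancel]

theorem map_rel_sup_normal (hσ : ε.comp σ = RingHom.id A) {E : Subgroup (SteinbergGroup P N R)}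
    [hE : E.Normal] (h : ⁅rel P N (M.map σ), rel P N (RingHom.ker ε)⁆ ≤ E) :
    ((rel P N M).map (map P N σ) ⊔ E).Normal := by
  set H := (rel P N M).map (map P N σ) ⊔ E
  have map_mem_H {v : SteinbergGroup P N A} (hv : v ∈ rel P N M) : map P N σ v ∈ H :=
    Subgroup.mem_sup_left ⟨v, hv, rfl⟩
  have conj_mem_H {w g : SteinbergGroup P N R}
      (hw : ∀ v ∈ rel P N M, MulAut.conj w (map P N σ v) ∈ H) (hg : g ∈ H) :
      MulAut.conj w g ∈ H := by
    refine sup_le (c := H.comap (MulAut.conj w).toMonoidHom) ?_ ?_ hg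
    · rintro _ ⟨v, hv, rfl⟩
      exact hw v hv
    · exact fun g hg => Subgroup.mem_sup_right (hE.conj_mem g hg w)
  refine normal_of_conj_x_mem P N fun i r g hg => ?_
  rw [x_eq_x_mul_map_x σ ε, map_mul, MulAut.mul_apply]
  refine conj_mem_H (fun v hv => ?_) (conj_mem_H (fun v hv => ?_) hg)
  · rw [conj_eq_commutatorElement_mul]
    refine mul_mem (Subgroup.mem_sup_right (h ?_)) (map_mem_H hv)
    rw [Subgroup.commutator_comm]
    exact Subgroup.commutator_mem_commutator (x_mem_rel P N i (sub_map_mem_ker hσ r))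
      (map_mem_rel P N σ Ideal.le_comap_map hv)
  · rw [MulAut.conj_apply, ← map_mul, ← map_inv, ← map_mul]
    exact map_mem_H ((rel_normal P N M).conj_mem v hv _)

theorem rel_map_le_sup (hσ : ε.comp σ = RingHom.id A) {E : Subgroup (SteinbergGroup P N R)}
    [E.Normal] (h_rel : rel P N (M.map σ * RingHom.ker ε) ≤ E)
    (h_commutator : ⁅rel P N (M.map σ), rel P N (RingHom.ker ε)⁆ ≤ E) :
    rel P N (M.map σ) ≤ (rel P N M).map (map P N σ) ⊔ E := by
  have := map_rel_sup_normal hσ h_commutator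
  refine rel_le P N fun i s hs => ?_
  rw [x_eq_x_mul_map_x σ ε]
  exact mul_mem
    (Subgroup.mem_sup_right (h_rel (x_mem_rel P N i (sub_map_mem_map_mul_ker hσ hs))))
    (Subgroup.mem_sup_left ⟨_, x_mem_rel P N i (apply_mem_of_mem_map hσ hs), rfl⟩)

theorem rel_map_inf_ker_le (hσ : ε.comp σ = RingHom.id A) {E : Subgroup (SteinbergGroup P N R)}
    [E.Normal] (hE : E ≤ (map P N ε).ker)
    (h : rel P N (M.map σ) ≤ (rel P N M).map (map P N σ) ⊔ E) :
    rel P N (M.map σ) ⊓ (map P N ε).ker ≤ E := by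
  rintro _ ⟨hg, hg_ker⟩
  obtain ⟨_, ⟨v, -, rfl⟩, u, hu, rfl⟩ := Subgroup.mem_sup_of_normal_right.mp (h hg)
  have hv : v = 1 := by
    have := MonoidHom.mem_ker.mp hg_ker
    rwa [map_mul, MonoidHom.mem_ker.mp (hE hu), mul_one, map_map_of_comp_eq_id hσ] at this
  rwa [hv, map_one, one_mul]

theorem crossed_le_rel_map_inf_ker {Γ : Set ι} :
    crossed P N Γ (M.map σ) (RingHom.ker ε) ≤ rel P N (M.map σ) ⊓ (map P N ε).ker := by
  refine le_inf (crossed_le (rel_mono P N Ideal.mul_le_left) fun i _ s hs t _ => ?_)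
    (crossed_le (rel_le_ker_map P N Ideal.mul_le_right) fun i _ s _ t ht => ?_)
  · exact Subgroup.commutator_le_left _ ⊤
      (Subgroup.commutator_mem_commutator (x_mem_rel P N i hs) (Subgroup.mem_top _))
  · rw [MonoidHom.mem_ker, map_c, RingHom.mem_ker.mp ht, c, x_zero, commutatorElement_one_right]

variable [Finite ι] [CharZero K] [P.IsCrystallographic] [IsSimplyLaced P] [HasRootSums P]
  [HasUnitConstants P N] [P.IsIrreducible]

theorem rel_map_inf_ker_eq_crossed (hσ : ε.comp σ = RingHom.id A) {Γ : Set ι} (hΓ : Γ.Nonempty) :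
    rel P N (M.map σ) ⊓ (map P N ε).ker = crossed P N Γ (M.map σ) (RingHom.ker ε) :=
  le_antisymm
    (rel_map_inf_ker_le hσ (crossed_le_rel_map_inf_ker.trans inf_le_right)
      (rel_map_le_sup hσ rel_mul_le_crossed (commutator_rel_le_crossed hΓ)))
    crossed_le_rel_map_inf_ker

end Split

section Polynomial

variable {A : Type*} [CommRing A] {M : Ideal A}

theorem evalKer_eq_inf : evalKer P N A M =
    rel P N (M.map (C : A →+* A[X])) ⊓ (map P N (evalRingHom (0 : A))).ker := by
  refine le_antisymm ?_ fun g hg => ⟨⟨g, hg.1⟩, Subtype.ext hg.2, rfl⟩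
  rintro _ ⟨g, hg, rfl⟩
  exact ⟨g.2, congrArg Subtype.val hg⟩

theorem c_mul_inv_c_mem_rel {I : Ideal R} (i : ι) {s s' : R} (h : s - s' ∈ I) (t : R) :
    c P N i s t * (c P N i s' t)⁻¹ ∈ rel P N I := by
  rw [mul_inv_mem_rel_iff, map_c, map_c, Ideal.Quotient.eq.mpr h]

variable [Finite ι] [CharZero K] [P.IsCrystallographic] [IsSimplyLaced P] [HasRootSums P]
  [HasUnitConstants P N] [P.IsIrreducible]

theorem evalKer_eq_closure {Γ : Set ι} (hΓ : Γ.Nonempty) :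
    evalKer P N A M =
      Subgroup.closure
        ((rel P N (Ideal.span {X} * M.map (C : A →+* A[X])) : Set _) ∪
          {g | ∃ i ∈ Γ, ∃ (m : A) (ξ : A[X]), m ∈ M ∧ g = c P N i (C m) (X * ξ)}) := by
  have comp_C : (evalRingHom (0 : A)).comp C = RingHom.id A := by ext; simp
  have ker_eval : RingHom.ker (evalRingHom (0 : A)) = Ideal.span {X} := by
    rw [ker_evalRingHom, C_0, sub_zero]
  rw [evalKer_eq_inf, rel_map_inf_ker_eq_crossed comp_C hΓ]
  refine le_antisymm (crossed_le ?_ fun i hi s hs t ht => ?_) ?_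
  · rw [ker_eval, mul_comm]
    exact fun g hg => Subgroup.subset_closure (.inl hg)
  · have s_congr := sub_map_mem_map_mul_ker comp_C hs
    rw [ker_eval, mul_comm] at s_congr
    refine (Subgroup.mul_mem_cancel_right _ (inv_mem (Subgroup.subset_closure (.inr ?_)))).mp
      (Subgroup.subset_closure (.inl (c_mul_inv_c_mem_rel i s_congr t)))
    obtain ⟨ξ, rfl⟩ := Ideal.mem_span_singleton.mp (ker_eval ▸ ht)
    exact ⟨i, hi, _, ξ, apply_mem_of_mem_map comp_C hs, rfl⟩
  · rw [Subgroup.closure_le, ← ker_eval, mul_comm]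
    rintro _ (hg | ⟨i, hi, m, ξ, hm, rfl⟩)
    · exact rel_mul_le_crossed hg
    · exact c_mem_crossed hi (Ideal.mem_map_of_mem C hm) (by simp [RingHom.mem_ker])

end Polynomial

end SteinbergGroup

theorem mainTheorem8_general {ι K V W A : Type*} [Finite ι] [Field K] [CharZero K]
    [AddCommGroup V] [Module K V] [AddCommGroup W] [Module K W]
    (P : RootPairing ι K V W) [P.IsRootSystem] [P.IsCrystallographic] [P.IsIrreducible]
    [IsSimplyLaced P]
    (hrank : 2 ≤ Module.finrank K V) (N : ι → ι → ℤ) [HasUnitConstants P N]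
    [CommRing A] (M : Ideal A) :
    SteinbergGroup.evalKer P N A M =
      Subgroup.closure
        ((SteinbergGroup.rel P N (Ideal.span {X} * M.map (C : A →+* A[X])) : Set _) ∪
          {g | ∃ (i : ι) (m : A) (ξ : A[X]), m ∈ M ∧
            g = SteinbergGroup.c P N i (C m) (X * ξ)}) ∧
    ∀ γ : ι, SteinbergGroup.evalKer P N A M =
      Subgroup.closure
        ((SteinbergGroup.rel P N (Ideal.span {X} * M.map (C : A →+* A[X])) : Set _) ∪
          {g | ∃ (m : A) (η : A[X]), m ∈ M ∧
            g = SteinbergGroup.c P N γ (C m) (X * η)}) := by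
  have : HasRootSums P := IsSimplyLaced.hasRootSums hrank
  have : Nonempty ι := nonempty_of_isIrreducible P
  constructor
  · simpa only [Set.mem_univ, true_and] using
      SteinbergGroup.evalKer_eq_closure (P := P) (N := N) (M := M) Set.univ_nonempty
  · intro γ
    simpa only [Set.mem_singleton_iff, exists_eq_left] using
      SteinbergGroup.evalKer_eq_closure (P := P) (N := N) (M := M) (Set.singleton_nonempty γ)

theorem mainTheorem8
    {ι K V W L A : Type*} [Finite ι] [Field K] [CharZero K]
    [AddCommGroup V] [Module K V] [AddCommGroup W] [Module K W]
    -- an irreducible reduced crystallographic root system of rank at least two,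
    (P : RootPairing ι K V W) [P.IsRootSystem] [P.IsCrystallographic] [P.IsReduced]
    [P.IsIrreducible] (hrank : 2 ≤ Module.finrank K V)
    -- whose Dynkin diagram is simply laced
    (b : P.Base) (hb : b.cartanMatrix.IsSimplyLaced)
    -- a choice of structure constants
    [LieRing L] [LieAlgebra K L] (B : ChevalleyBasis P L)
    [CommRing A] [IsLocalRing A] :
    SteinbergGroup.evalKer P B.N A (maximalIdeal A) =
      Subgroup.closure
        ((SteinbergGroup.rel P B.N
            (Ideal.span {X} * (maximalIdeal A).map (C : A →+* A[X])) : Set _) ∪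
          {g | ∃ (i : ι) (m : A) (ξ : A[X]), m ∈ maximalIdeal A ∧
            g = SteinbergGroup.c P B.N i (C m) (X * ξ)}) ∧
    ∀ γ : ι, SteinbergGroup.evalKer P B.N A (maximalIdeal A) =
      Subgroup.closure
        ((SteinbergGroup.rel P B.N
            (Ideal.span {X} * (maximalIdeal A).map (C : A →+* A[X])) : Set _) ∪
          {g | ∃ (m : A) (η : A[X]), m ∈ maximalIdeal A ∧
            g = SteinbergGroup.c P B.N γ (C m) (X * η)}) := by
  have : IsSimplyLaced P := IsSimplyLaced.of_base b hb
  exact mainTheorem8_general P hrank B.N (maximalIdeal A)
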